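/- All manifolds are finite-dimensional, Hausdorff, second countable, without boundary, and smooth ($C^\infty$). Let $M$ and $N$ be manifolds, let $\Pi : M \to N$ be a surjective submersion, let $X$ be a smooth vector field on $M$, and put $l = \dim M - \dim N$. For an open set $U \subset M$ the image $\Pi(U)$ is open in $N$; write $\Pi|_U : U \to \Pi(U)$ and $X|_U$ for the restrictions of $\Pi$ and $X$. A solution of the $\Pi|_U$-Hamilton–Jacobi equation (HJE) for $(U, X|_U)$ is a smooth section $\sigma : \Pi(U) \to U$ of $\Pi|_U$ with $$\sigma_* \circ (\Pi|_U)_* \circ X|_U \circ \sigma = X|_U \circ \sigma .$$ Given an $l$-dimensional manifold $\Lambda$, a complete solution of the $\Pi|_U$-HJE for $(U, X|_U)$ is a surjective local diffeomorphism $\Sigma : \Pi(U) \times \Lambda \to U$ such that, for every $\lambda \in \Lambda$, the map $\Sigma(\cdot, \lambda) : \Pi(U) \to U$ is a solution of the $\Pi|_U$-HJE for $(U, X|_U)$. Theorem. Let $m \in M$ be a point with $X(m) \notin \operatorname{Ker} \Pi_{*,m}$. Then there exist an open neighbourhood $U$ of $m$, an $l$-dimensional manifold $\Lambda$, and a complete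 solution $\Sigma : \Pi(U) \times \Lambda \to U$ of the $\Pi|_U$-HJE for $(U, X|_U)$. -/

import Mathlib

open scoped Manifold ContDiff Topology

namespace HamiltonJacobi

/-- A fibration `P : M → N` between smooth manifolds of dimensions `d` and `k`: a smooth surjective
map whose differential is surjective at every point (a surjective submersion). -/
structure IsFibration (d k : ℕ)
    {M : Type*} [TopologicalSpace M] [ChartedSpace (EuclideanSpace ℝ (Fin d)) M]
    {N : Type*} [TopologicalSpace N] [ChartedSpace (EuclideanSpace ℝ (Fin k)) N]
    (P : M → N) : Prop where
  contMDiff : ContMDiff (𝓡 d) (𝓡 k) ∞ P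
  surjective : Function.Surjective P
  surjective_mfderiv : ∀ m : M, Function.Surjective (mfderiv (𝓡 d) (𝓡 k) P m)

/-- A fibration is an open map. -/
theorem IsFibration.isOpenMap {d k : ℕ}
    {M : Type*} [TopologicalSpace M] [ChartedSpace (EuclideanSpace ℝ (Fin d)) M]
    {N : Type*} [TopologicalSpace N] [ChartedSpace (EuclideanSpace ℝ (Fin k)) N]
    {P : M → N} (hP : IsFibration d k P) : IsOpenMap P := by
  rw [isOpenMap_iff_nhds_le]
  intro m
  have hs : ContMDiffAt (𝓡 d) (𝓡 k) ∞ P m := hP.contMDiff m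
  have hc := (contMDiffAt_iff.1 hs).2
  have hd : ContDiffAt ℝ ∞ (writtenInExtChartAt (𝓡 d) (𝓡 k) m P) (extChartAt (𝓡 d) m m) := by
    simpa only [writtenInExtChartAt, ModelWithCorners.range_eq_univ, contDiffWithinAt_univ] using hc
  have hsurj := hP.surjective_mfderiv m
  rw [(hs.mdifferentiableAt (by simp)).mfderiv] at hsurj
  simp only [ModelWithCorners.range_eq_univ, fderivWithin_univ] at hsurj
  have hst := hd.hasStrictFDerivAt (by simp)
  have hmap := hst.map_nhds_eq_of_surj (LinearMap.range_eq_top.2 hsurj)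
  rw [← map_extChartAt_nhds_of_boundaryless m, Filter.map_map] at hmap
  have hval : writtenInExtChartAt (𝓡 d) (𝓡 k) m P (extChartAt (𝓡 d) m m)
      = extChartAt (𝓡 k) (P m) (P m) := by simp [writtenInExtChartAt]
  rw [hval] at hmap
  have hsymm := map_extChartAt_symm_nhdsWithin_range (I := 𝓡 k) (P m)
  rw [ModelWithCorners.range_eq_univ, nhdsWithin_univ, ← hmap, Filter.map_map] at hsymm
  rw [← hsymm]
  refine (Filter.map_congr ?_).le
  have h1 : ∀ᶠ x in 𝓝 m, x ∈ (extChartAt (𝓡 d) m).source := extChartAt_source_mem_nhds m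
  have h2 : ∀ᶠ x in 𝓝 m, P x ∈ (extChartAt (𝓡 k) (P m)).source :=
    hs.continuousAt (extChartAt_source_mem_nhds (P m))
  filter_upwards [h1, h2] with x hx1 hx2
  simp only [Function.comp_apply, writtenInExtChartAt]
  rw [(extChartAt (𝓡 d) m).left_inv hx1, (extChartAt (𝓡 k) (P m)).left_inv hx2]

/-- The image `P(U)` of an open set `U ⊆ M` under a fibration, as an open submanifold of `N`. -/
def IsFibration.image {d k : ℕ}
    {M : Type*} [TopologicalSpace M] [ChartedSpace (EuclideanSpace ℝ (Fin d)) M]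
    {N : Type*} [TopologicalSpace N] [ChartedSpace (EuclideanSpace ℝ (Fin k)) N]
    {P : M → N} (hP : IsFibration d k P) (U : TopologicalSpace.Opens M) :
    TopologicalSpace.Opens N :=
  ⟨P '' U, hP.isOpenMap U U.isOpen⟩

/-- The restricted fibration `P|_U : U → P(U)`. -/
def IsFibration.restrict {d k : ℕ}
    {M : Type*} [TopologicalSpace M] [ChartedSpace (EuclideanSpace ℝ (Fin d)) M]
    {N : Type*} [TopologicalSpace N] [ChartedSpace (EuclideanSpace ℝ (Fin k)) N]
    {P : M → N} (hP : IsFibration d k P) (U : TopologicalSpace.Opens M) (u : U) : hP.image U :=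
  ⟨P u, Set.mem_image_of_mem P u.2⟩

/-- The restriction `X|_U` of a vector field to an open submanifold: the pullback of `X` along
the inclusion `U → M`, whose differential is invertible at every point. -/
noncomputable def restrictField {d : ℕ}
    {M : Type*} [TopologicalSpace M] [ChartedSpace (EuclideanSpace ℝ (Fin d)) M]
    (X : ∀ m : M, TangentSpace (𝓡 d) m) (U : TopologicalSpace.Opens M) :
    ∀ u : U, TangentSpace (𝓡 d) u :=
  VectorField.mpullback (𝓡 d) (𝓡 d) (Subtype.val : U → M) X

/-- A vector field viewed as a map `M → TM`. -/
def fieldMap {d : ℕ}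
    {M : Type*} [TopologicalSpace M] [ChartedSpace (EuclideanSpace ℝ (Fin d)) M]
    (X : ∀ m : M, TangentSpace (𝓡 d) m) (m : M) : TangentBundle (𝓡 d) M :=
  ⟨m, X m⟩

/-- `s : N → M` is a solution of the `P`-Hamilton-Jacobi equation for `(M, X)`: a smooth section
of `P` with `s_* ∘ P_* ∘ X ∘ s = X ∘ s`. -/
structure IsHJESolution (d k : ℕ)
    {M : Type*} [TopologicalSpace M] [ChartedSpace (EuclideanSpace ℝ (Fin d)) M]
    {N : Type*} [TopologicalSpace N] [ChartedSpace (EuclideanSpace ℝ (Fin k)) N]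
    (P : M → N) (X : ∀ m : M, TangentSpace (𝓡 d) m) (s : N → M) : Prop where
  contMDiff : ContMDiff (𝓡 k) (𝓡 d) ∞ s
  comp_eq_id : P ∘ s = id
  hje : tangentMap (𝓡 k) (𝓡 d) s ∘ tangentMap (𝓡 d) (𝓡 k) P ∘ fieldMap X ∘ s = fieldMap X ∘ s

/-- `S : N × Λ → M` is a complete solution of the `P`-Hamilton-Jacobi equation for `(M, X)`. -/
structure IsCompleteSolution (d k l : ℕ)
    {M : Type*} [TopologicalSpace M] [ChartedSpace (EuclideanSpace ℝ (Fin d)) M]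
    {N : Type*} [TopologicalSpace N] [ChartedSpace (EuclideanSpace ℝ (Fin k)) N]
    {Λ : Type*} [TopologicalSpace Λ] [ChartedSpace (EuclideanSpace ℝ (Fin l)) Λ]
    (P : M → N) (X : ∀ m : M, TangentSpace (𝓡 d) m) (S : N × Λ → M) : Prop where
  surjective : Function.Surjective S
  isLocalDiffeomorph : IsLocalDiffeomorph ((𝓡 k).prod (𝓡 l)) (𝓡 d) ∞ S
  partial_solution : ∀ a : Λ, IsHJESolution d k P X (fun n => S (n, a))

end HamiltonJacobi

/-! A section solves the HJE exactly when `X` is tangent to its image, so a complete solution is a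
local foliation by `X`-invariant images of sections. Such a foliation comes from a map `Q` with `l`
components, annihilated by `X`, such that `(P, Q)` is a diffeomorphism onto a product: its inverse
`T` is the complete solution. Indeed, on the leaf `Q = a` the map `T ∘ (P, a)` differs from `T ∘ (P,
Q) = id` only in a component whose differential kills `X`.

To find `Q`, read everything in charts. Since `P_* X` is nonzero at `m`, `X` does not vanish there
and can be straightened to a constant field (`exists_straightening`). Transversality allows a linear
`B` that kills this constant vector and restricts to an isomorphism on `ker P_*`
(`exists_complementary_clm`). Take `Q` to be `B` after the straightening, and apply the inverse
function theorem to `(P, Q)`.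

Straightening needs a flow that is smooth in time and initial point. It comes from the implicit
function theorem in the Banach space of curves on `[-1, 1]`, applied to `γ = x + τ ∫ v(γ)`. This
requires `γ ↦ v ∘ γ` to be smooth for the sup norm. -/

namespace ContinuousMap

/-! ### Smoothness of composition operators on spaces of curves -/

variable {K : Type*} [TopologicalSpace K] [CompactSpace K]

/-- Pointwise application of a continuous family of continuous linear maps, as a bounded bilinear
map. -/
noncomputable def pointwiseApplyL (K : Type*) [TopologicalSpace K] [CompactSpace K]
    (E F : Type*) [NormedAddCommGroup E] [NormedSpace ℝ E]
    [NormedAddCommGroup F] [NormedSpace ℝ F] :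
    C(K, E →L[ℝ] F) →L[ℝ] C(K, E) →L[ℝ] C(K, F) :=
  LinearMap.mkContinuous₂
    (LinearMap.mk₂ ℝ (fun (A : C(K, E →L[ℝ] F)) (g : C(K, E)) =>
        (⟨fun t => A t (g t), A.continuous.clm_apply g.continuous⟩ : C(K, F)))
      (fun _ _ _ => by ext; simp) (fun _ _ _ => by ext; simp)
      (fun _ _ _ => by ext; simp) (fun _ _ _ => by ext; simp))
    1 (fun A g => by
      rw [one_mul, ContinuousMap.norm_le _ (by positivity)]
      intro t
      exact ((A t).le_opNorm _).trans
        (mul_le_mul (A.norm_coe_le_norm t) (g.norm_coe_le_norm t) (norm_nonneg _) (norm_nonneg A)))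

@[simp]
theorem pointwiseApplyL_apply {E F : Type*} [NormedAddCommGroup E] [NormedSpace ℝ E]
    [NormedAddCommGroup F] [NormedSpace ℝ F] (A : C(K, E →L[ℝ] F)) (g : C(K, E)) (t : K) :
    pointwiseApplyL K E F A g t = A t (g t) := rfl

/-- The composition operator `γ ↦ f ∘ γ` is differentiable when `f` is `C^1`. -/
theorem hasFDerivAt_comp_left {E F : Type*} [NormedAddCommGroup E] [NormedSpace ℝ E]
    [NormedAddCommGroup F] [NormedSpace ℝ F] (f : C(E, F)) (f' : C(E, E →L[ℝ] F))
    (hf : ∀ x, HasFDerivAt f (f' x) x) (γ : C(K, E)) :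
    HasFDerivAt (fun γ : C(K, E) => f.comp γ) (pointwiseApplyL K E F (f'.comp γ)) γ := by
  rw [hasFDerivAt_iff_isLittleO_nhds_zero, Asymptotics.isLittleO_iff]
  intro c hc
  have hcont : Continuous (fun γ : C(K, E) => f'.comp γ) := f'.continuous_postcomp
  obtain ⟨η, hη, H⟩ := (Metric.continuous_iff (α := C(K, E)) (β := C(K, E →L[ℝ] F))).1 hcont γ c hc
  filter_upwards [Metric.ball_mem_nhds (0 : C(K, E)) hη] with δ hδ
  rw [mem_ball_zero_iff] at hδ
  rw [ContinuousMap.norm_le _ (by positivity)]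
  intro t
  -- Shifting the whole curve `γ` by the constant `y - γ t` turns sup-norm continuity of `γ ↦ f' ∘
  -- γ` into a bound on `f'` with a radius independent of `t`.
  have key : ∀ y ∈ Metric.closedBall (γ t) ‖δ‖, ‖f' y - f' (γ t)‖ ≤ c := by
    intro y hy
    have h1 : dist (γ + ContinuousMap.const K (y - γ t)) γ < η := by
      rw [dist_eq_norm, add_sub_cancel_left]
      refine lt_of_le_of_lt ?_ hδ
      rw [ContinuousMap.norm_le _ (norm_nonneg _)]
      intro s
      simpa [dist_eq_norm] using hy
    have h2 := (ContinuousMap.dist_apply_le_dist (f := f'.comp (γ + ContinuousMap.const K (y - γ t)))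
      (g := f'.comp γ) t).trans (H _ h1).le
    simpa [dist_eq_norm] using h2
  have hmv := (convex_closedBall (γ t) ‖δ‖).norm_image_sub_le_of_norm_hasFDerivWithin_le'
    (f := f) (f' := f') (φ := f' (γ t)) (C := c) (x := γ t) (y := γ t + δ t)
    (fun x _ => (hf x).hasFDerivWithinAt) key (by simp)
    (by simpa [dist_eq_norm] using δ.norm_coe_le_norm t)
  refine le_trans ?_ (hmv.trans ?_)
  · simp
  · rw [add_sub_cancel_left]
    gcongr
    exact δ.norm_coe_le_norm t

/-- The composition operator `γ ↦ f ∘ γ` is `C^n` when `f` is `C^n`. -/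
theorem contDiff_comp_left_nat.{u} {E : Type u} [NormedAddCommGroup E] [NormedSpace ℝ E] (n : ℕ) :
    ∀ {F : Type u} [NormedAddCommGroup F] [NormedSpace ℝ F] (f : C(E, F)),
      ContDiff ℝ n f → ContDiff ℝ n (fun γ : C(K, E) => f.comp γ) := by
  induction n with
  | zero =>
    intro F _ _ f _
    exact contDiff_zero.2 f.continuous_postcomp
  | succ n ih =>
    intro F _ _ f hf
    -- The derivative is the composition operator of `f'` followed by a bounded linear map. The
    -- induction therefore ranges over all codomains in one universe, as `F` is replaced by `E →L[ℝ]
    -- F`.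
    obtain ⟨f', hf', hff'⟩ := contDiff_succ_iff_hasFDerivAt.1 hf
    have h1 : ContDiff ℝ n (fun γ : C(K, E) =>
        (⟨f', hf'.continuous⟩ : C(E, E →L[ℝ] F)).comp γ) := ih ⟨f', hf'.continuous⟩ hf'
    have h2 : ContDiff ℝ n (pointwiseApplyL K E F) :=
      ContinuousLinearMap.contDiff (E := C(K, E →L[ℝ] F)) (F := C(K, E) →L[ℝ] C(K, F)) _
    exact contDiff_succ_iff_hasFDerivAt.2
      ⟨fun γ => pointwiseApplyL K E F ((⟨f', hf'.continuous⟩ : C(E, E →L[ℝ] F)).comp γ),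
        h2.comp h1, hasFDerivAt_comp_left f ⟨f', hf'.continuous⟩ hff'⟩

/-- The composition operator `γ ↦ f ∘ γ` is smooth when `f` is smooth. -/
theorem contDiff_comp_left.{u} {E F : Type u} [NormedAddCommGroup E] [NormedSpace ℝ E]
    [NormedAddCommGroup F] [NormedSpace ℝ F] (f : C(E, F)) (hf : ContDiff ℝ ∞ f) :
    ContDiff ℝ ∞ (fun γ : C(K, E) => f.comp γ) :=
  contDiff_infty.2 fun n => contDiff_comp_left_nat n f (contDiff_infty.1 hf n)

end ContinuousMap

/-! ### Implicit functions near the base point -/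

/-- The implicit function defined by a smooth equation is smooth near the base point. -/
theorem ContDiff.eventually_contDiffAt_implicitFunction {E₁ E₂ F : Type*}
    [NormedAddCommGroup E₁] [NormedSpace ℝ E₁] [CompleteSpace E₁]
    [NormedAddCommGroup E₂] [NormedSpace ℝ E₂] [CompleteSpace E₂]
    [NormedAddCommGroup F] [NormedSpace ℝ F] [CompleteSpace F]
    {f : E₁ × E₂ → F} (hf : ContDiff ℝ ∞ f) {u : E₁ × E₂}
    (hinv : (fderiv ℝ f u ∘L .inr ℝ E₁ E₂).IsInvertible) :
    ∀ᶠ p in 𝓝 u.1,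
      ContDiffAt ℝ ∞ (hf.contDiffAt.implicitFunction (u := u) (by simp) hinv) p := by
  have hfa : ∀ w, ContDiffAt ℝ ∞ f w := fun w => hf.contDiffAt
  set ψ := (hfa u).implicitFunction (by simp) hinv with hψ
  have hψc : ContinuousAt ψ u.1 := ((hfa u).contDiffAt_implicitFunction _ hinv).continuousAt
  have hgraph : Filter.Tendsto (fun p => (p, ψ p)) (𝓝 u.1) (𝓝 u) := by
    have h := continuousAt_id.prodMk hψc
    have h0 : ψ u.1 = u.2 := (hfa u).implicitFunction_apply_self _ hinv
    rwa [ContinuousAt, h0] at h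
  have hopen : IsOpen {L : E₂ →L[ℝ] F | L.IsInvertible} := ContinuousLinearEquiv.isOpen
  have hcont : Continuous fun w => fderiv ℝ f w ∘L .inr ℝ E₁ E₂ :=
    (hf.continuous_fderiv (by simp)).clm_comp continuous_const
  have hinv' : ∀ᶠ w in 𝓝 u, (fderiv ℝ f w ∘L .inr ℝ E₁ E₂).IsInvertible :=
    hcont.continuousAt.eventually_mem (hopen.mem_nhds hinv)
  have hiff := (hfa u).eventually_apply_eq_iff_implicitFunction (by simp) hinv
  filter_upwards [hgraph.eventually hinv', hgraph.eventually hiff.eventually_nhds,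
    (hfa u).eventually_apply_implicitFunction (by simp) hinv] with p hp hp' hfp
  -- `ContDiffAt ℝ ∞` at one point does not by itself spread to a neighbourhood. The implicit
  -- function theorem is applied afresh at `w`, and local uniqueness identifies the new function `χ`
  -- with `ψ` near `p`.
  set w : E₁ × E₂ := (p, ψ p)
  refine ((hfa w).contDiffAt_implicitFunction (by simp) hp).congr_of_eventuallyEq ?_
  set χ := (hfa w).implicitFunction (by simp) hp
  have hχ : Filter.Tendsto (fun q => (q, χ q)) (𝓝 w.1) (𝓝 w) := by
    have hχc : ContinuousAt χ w.1 :=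
      ((hfa w).contDiffAt_implicitFunction (by simp) hp).continuousAt
    have h := continuousAt_id.prodMk hχc
    have h0 : χ w.1 = w.2 := (hfa w).implicitFunction_apply_self _ hp
    rwa [ContinuousAt, h0] at h
  filter_upwards [hχ.eventually hp', (hfa w).eventually_apply_implicitFunction (by simp) hp]
    with q hq hq'
  exact hq.1 (hq'.trans hfp)

/-! ### Smooth local flows -/

section Flow

open Set

theorem neg_one_le_one_real : (-1 : ℝ) ≤ 1 := by norm_num

/-- The extension to the line of a curve on `[-1, 1]`, constant outside. -/
noncomputable def extendCurve {E : Type*} [NormedAddCommGroup E]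
    (g : C(Icc (-1 : ℝ) 1, E)) : ℝ → E :=
  IccExtend neg_one_le_one_real g

theorem continuous_extendCurve {E : Type*} [NormedAddCommGroup E]
    (g : C(Icc (-1 : ℝ) 1, E)) : Continuous (extendCurve g) :=
  g.continuous.Icc_extend'

theorem extendCurve_of_mem {E : Type*} [NormedAddCommGroup E]
    (g : C(Icc (-1 : ℝ) 1, E)) {s : ℝ} (hs : s ∈ Icc (-1 : ℝ) 1) :
    extendCurve g s = g ⟨s, hs⟩ :=
  IccExtend_of_mem _ _ hs

theorem norm_extendCurve_le {E : Type*} [NormedAddCommGroup E]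
    (g : C(Icc (-1 : ℝ) 1, E)) (s : ℝ) : ‖extendCurve g s‖ ≤ ‖g‖ :=
  g.norm_coe_le_norm _

/-- Integration from `0`, as an operator on curves `[-1, 1] → E`. -/
noncomputable def primitiveL (E : Type*) [NormedAddCommGroup E] [NormedSpace ℝ E] :
    C(Icc (-1 : ℝ) 1, E) →L[ℝ] C(Icc (-1 : ℝ) 1, E) :=
  LinearMap.mkContinuous
    { toFun := fun g =>
        ⟨fun s => ∫ σ in (0 : ℝ)..s, extendCurve g σ,
          (intervalIntegral.continuous_primitive
            (fun _ _ => (continuous_extendCurve g).intervalIntegrable _ _) 0).comp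
            continuous_subtype_val⟩
      map_add' := fun g h => by
        ext s
        exact intervalIntegral.integral_add
          ((continuous_extendCurve g).intervalIntegrable _ _)
          ((continuous_extendCurve h).intervalIntegrable _ _)
      map_smul' := fun c g => by
        ext s
        exact intervalIntegral.integral_smul c (extendCurve g) }
    1 (fun g => by
      rw [one_mul, ContinuousMap.norm_le _ (norm_nonneg _)]
      intro s
      refine (intervalIntegral.norm_integral_le_of_norm_le_const
        fun σ _ => norm_extendCurve_le g σ).trans ?_
      rw [sub_zero]
      exact mul_le_of_le_one_right (norm_nonneg _) (abs_le.2 s.2))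

theorem primitiveL_apply {E : Type*} [NormedAddCommGroup E] [NormedSpace ℝ E]
    (g : C(Icc (-1 : ℝ) 1, E)) (s : Icc (-1 : ℝ) 1) :
    primitiveL E g s = ∫ σ in (0 : ℝ)..s, extendCurve g σ := rfl

/-- The integral equation `γ(s) = x + τ ∫₀ˢ v(γ)` on `[-1, 1]` has a unique small solution, which
depends smoothly on `(τ, x)`. -/
theorem exists_contDiffAt_integralCurve.{u} {E : Type u} [NormedAddCommGroup E] [NormedSpace ℝ E]
    [CompleteSpace E] (v : C(E, E)) (hv : ContDiff ℝ ∞ v) (x₀ : E) :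
    ∃ Γ : ℝ × E → C(Icc (-1 : ℝ) 1, E), (∀ᶠ w in 𝓝 (0, x₀), ContDiffAt ℝ ∞ Γ w) ∧
      Γ (0, x₀) = ContinuousMap.const _ x₀ ∧
      ∀ᶠ w : (ℝ × E) × C(Icc (-1 : ℝ) 1, E) in 𝓝 ((0, x₀), ContinuousMap.const _ x₀),
        w.2 = ContinuousMap.const _ w.1.2 + w.1.1 • primitiveL E (v.comp w.2) ↔ Γ w.1 = w.2 := by
  let I := Icc (-1 : ℝ) 1
  let constL : E →L[ℝ] C(I, E) := ContinuousLinearMap.const ℝ I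
  let f : (ℝ × E) × C(I, E) → C(I, E) :=
    fun w => w.2 - constL w.1.2 - w.1.1 • primitiveL E (v.comp w.2)
  have hcomp : ContDiff ℝ ∞ (fun w : (ℝ × E) × C(I, E) => v.comp w.2) :=
    (ContinuousMap.contDiff_comp_left v hv).comp contDiff_snd
  have hf : ContDiff ℝ ∞ f := by
    have h1 : ContDiff ℝ ∞ (fun w : (ℝ × E) × C(I, E) => primitiveL E (v.comp w.2)) :=
      (primitiveL E).contDiff.comp hcomp
    have h2 : ContDiff ℝ ∞ (fun w : (ℝ × E) × C(I, E) => constL w.1.2) :=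
      constL.contDiff.comp (contDiff_snd.comp contDiff_fst)
    exact (contDiff_snd.sub h2).sub ((contDiff_fst.comp contDiff_fst).smul h1)
  let u : (ℝ × E) × C(I, E) := ((0, x₀), ContinuousMap.const _ x₀)
  have hfu : f u = 0 := by
    ext s
    simp [f, u, constL]
  -- With time rescaled to the fixed interval, `τ` multiplies the integral, so at `τ = 0` the
  -- nonlinear term disappears from the partial derivative.
  have hinr : fderiv ℝ f u ∘L .inr ℝ (ℝ × E) C(I, E) = .id ℝ C(I, E) := by
    have h1 : HasFDerivAt (fun γ : C(I, E) => f ((0, x₀), γ))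
        (fderiv ℝ f u ∘L .inr ℝ (ℝ × E) C(I, E)) u.2 :=
      (hf.differentiable (by simp) u).hasFDerivAt.comp u.2 (hasFDerivAt_prodMk_right (0, x₀) u.2)
    have h2 : HasFDerivAt (fun γ : C(I, E) => f ((0, x₀), γ)) (.id ℝ C(I, E)) u.2 := by
      simpa [f] using (hasFDerivAt_id (𝕜 := ℝ) u.2).sub_const (constL x₀)
    exact h1.unique h2
  have hinv : (fderiv ℝ f u ∘L .inr ℝ (ℝ × E) C(I, E)).IsInvertible := by
    rw [hinr]
    exact ⟨ContinuousLinearEquiv.refl ℝ _, rfl⟩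
  have hfa : ContDiffAt ℝ ∞ f u := hf.contDiffAt
  refine ⟨hfa.implicitFunction (by simp) hinv, hf.eventually_contDiffAt_implicitFunction hinv,
    hfa.implicitFunction_apply_self _ hinv, ?_⟩
  filter_upwards [hfa.eventually_apply_eq_iff_implicitFunction (by simp) hinv] with w hw
  refine Iff.trans ?_ (show f w = f u ↔ _ from hw)
  rw [hfu, ← sub_eq_zero, sub_add_eq_sub_sub]
  rfl

/-- Smooth dependence on initial conditions: a smooth vector field on a Banach space has a smooth
local flow near each point. -/
theorem exists_contDiffAt_flow.{u} {E : Type u} [NormedAddCommGroup E] [NormedSpace ℝ E]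
    [CompleteSpace E] {v : E → E} (hv : ContDiff ℝ ∞ v) (x₀ : E) :
    ∃ Φ : ℝ × E → E, (∀ᶠ w in 𝓝 (0, x₀), ContDiffAt ℝ ∞ Φ w) ∧
      (∀ᶠ x in 𝓝 x₀, Φ (0, x) = x) ∧
      ∀ᶠ w in 𝓝 ((0 : ℝ), x₀), HasDerivAt (fun t => Φ (t, w.2)) (v (Φ w)) w.1 := by
  obtain ⟨Γ, hΓ, hΓ₀, hiff⟩ := exists_contDiffAt_integralCurve ⟨v, hv.continuous⟩ hv x₀
  set V : C(E, E) := ⟨v, hv.continuous⟩ with hV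
  let one : Icc (-1 : ℝ) 1 := ⟨1, by norm_num, le_rfl⟩
  obtain ⟨ε, hε, hiff⟩ := Metric.eventually_nhds_iff_ball.1 hiff
  obtain ⟨δ, hδ, hclose⟩ := Metric.continuousAt_iff.1 hΓ.self_of_nhds.continuousAt ε hε
  -- a common radius for the parameters
  obtain ⟨r, hr, hrδ, hrε⟩ : ∃ r > 0, r < δ ∧ r < ε :=
    ⟨min δ ε / 2, by positivity, by have := min_le_left δ ε; have := lt_min hδ hε; linarith,
      by have := min_le_right δ ε; have := lt_min hδ hε; linarith⟩
  have hmem : ∀ τ x, |τ| ≤ r → ‖x - x₀‖ ≤ r → dist (Γ (τ, x)) (ContinuousMap.const _ x₀) < ε := by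
    intro τ x hτ hx
    rw [← hΓ₀]
    refine hclose ?_
    rw [Prod.dist_eq, max_lt_iff]
    simp only [dist_eq_norm, sub_zero, Real.norm_eq_abs]
    exact ⟨by linarith, by linarith⟩
  have hΓeq : ∀ τ x γ, |τ| ≤ r → ‖x - x₀‖ ≤ r → dist γ (ContinuousMap.const _ x₀) < ε →
      (γ = ContinuousMap.const _ x + τ • primitiveL E (V.comp γ) ↔ Γ (τ, x) = γ) := by
    intro τ x γ hτ hx hγ
    refine hiff ((τ, x), γ) ?_
    simp only [Metric.mem_ball, Prod.dist_eq, max_lt_iff]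
    simp only [dist_eq_norm, sub_zero, Real.norm_eq_abs] at hγ ⊢
    exact ⟨⟨by linarith, by linarith⟩, hγ⟩
  have hsol : ∀ τ x, |τ| ≤ r → ‖x - x₀‖ ≤ r → ∀ s ∈ Icc (-1 : ℝ) 1,
      extendCurve (Γ (τ, x)) s = x + τ • ∫ σ in (0 : ℝ)..s, v (extendCurve (Γ (τ, x)) σ) := by
    intro τ x hτ hx s hs
    have h := (hΓeq τ x _ hτ hx (hmem τ x hτ hx)).2 rfl
    rw [extendCurve_of_mem _ hs]
    conv_lhs => rw [h]
    rfl
  -- The curve `s ↦ Γ (r, x) (c s)` solves the equation with parameter `c r`, so uniqueness makes it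
  -- `Γ (c r, x)`. Thus the parameter `τ` acts as time along a single curve.
  have hscale : ∀ c x, |c| ≤ 1 → ‖x - x₀‖ ≤ r → Γ (c * r, x) one = extendCurve (Γ (r, x)) c := by
    intro c x hc hx
    have habs : |r| ≤ r := (abs_of_pos hr).le
    have hcr : |c * r| ≤ r := by
      rw [abs_mul, abs_of_pos hr]
      exact mul_le_of_le_one_left hr.le hc
    have hcmem : ∀ s ∈ Icc (-1 : ℝ) 1, c * s ∈ Icc (-1 : ℝ) 1 := by
      intro s hs
      rw [mem_Icc, ← abs_le, abs_mul]
      exact mul_le_one₀ hc (abs_nonneg _) (abs_le.2 hs)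
    let β : C(Icc (-1 : ℝ) 1, E) :=
      ⟨fun s => extendCurve (Γ (r, x)) (c * s),
        (continuous_extendCurve _).comp (continuous_const.mul continuous_subtype_val)⟩
    have hβ : dist β (ContinuousMap.const _ x₀) < ε := by
      refine lt_of_le_of_lt ?_ (hmem r x habs hx)
      rw [ContinuousMap.dist_le dist_nonneg]
      intro s
      exact ContinuousMap.dist_apply_le_dist (f := Γ (r, x)) (g := ContinuousMap.const _ x₀) _
    have hβeq : Γ (c * r, x) = β := by
      rw [← hΓeq _ _ _ hcr hx hβ]
      ext s
      have h1 : β s = x + r • ∫ σ in (0 : ℝ)..(c * s), v (extendCurve (Γ (r, x)) σ) :=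
        hsol r x habs hx _ (hcmem s s.2)
      have h2 : (∫ σ in (0 : ℝ)..s, extendCurve (V.comp β) σ)
          = ∫ σ in (0 : ℝ)..s, v (extendCurve (Γ (r, x)) (c * σ)) := by
        refine intervalIntegral.integral_congr fun σ hσ => ?_
        have hσ' : σ ∈ Icc (-1 : ℝ) 1 :=
          uIcc_subset_Icc (⟨by norm_num, by norm_num⟩ : (0 : ℝ) ∈ Icc (-1 : ℝ) 1) s.2 hσ
        simp only [extendCurve_of_mem _ hσ']
        rfl
      have h3 := intervalIntegral.smul_integral_comp_mul_left (a := 0) (b := (s : ℝ))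
        (fun σ => v (extendCurve (Γ (r, x)) σ)) c
      rw [mul_zero] at h3
      rw [h1, ← h3, smul_smul, mul_comm r c]
      simp only [ContinuousMap.add_apply, ContinuousMap.const_apply, ContinuousMap.smul_apply,
        primitiveL_apply, h2]
    rw [hβeq]
    simp [β, one]
  refine ⟨fun w => Γ w one, ?_, ?_, ?_⟩
  · filter_upwards [hΓ] with w hw
    exact (ContinuousMap.evalCLM ℝ one).contDiff.contDiffAt.comp _ hw
  · filter_upwards [Metric.ball_mem_nhds x₀ hr] with x hx
    have hx' : ‖x - x₀‖ ≤ r := by rw [← dist_eq_norm]; exact (Metric.mem_ball.1 hx).le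
    have h := hsol 0 x (by simpa using hr.le) hx' 1 (by norm_num)
    rw [extendCurve_of_mem _ (by norm_num)] at h
    simpa using h
  · filter_upwards [Metric.ball_mem_nhds ((0 : ℝ), x₀) hr] with w hw
    obtain ⟨τ, x⟩ := w
    rw [Metric.mem_ball, Prod.dist_eq, max_lt_iff] at hw
    simp only [dist_eq_norm, sub_zero, Real.norm_eq_abs] at hw
    obtain ⟨hτ, hx⟩ := hw
    -- For fixed `x`, every small time is now read on the one curve `Γ (r, x)`, so the fundamental
    -- theorem of calculus applies; the factors `r` and `1 / r` cancel.
    have hev : ∀ t, |t| < r →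
        Γ (t, x) one = x + r • ∫ σ in (0 : ℝ)..(t / r), v (extendCurve (Γ (r, x)) σ) := by
      intro t ht
      have hc : |t / r| ≤ 1 := by
        rw [abs_div, abs_of_pos hr]
        exact (div_le_one hr).2 ht.le
      have h := hscale (t / r) x hc hx.le
      rw [div_mul_cancel₀ _ hr.ne'] at h
      rw [h]
      exact hsol r x (abs_of_pos hr).le hx.le _ (abs_le.1 hc)
    have hval : Γ (τ, x) one = extendCurve (Γ (r, x)) (τ / r) := by
      have hc : |τ / r| ≤ 1 := by
        rw [abs_div, abs_of_pos hr]
        exact (div_le_one hr).2 hτ.le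
      have h := hscale (τ / r) x hc hx.le
      rwa [div_mul_cancel₀ _ hr.ne'] at h
    have hcont : Continuous fun σ => v (extendCurve (Γ (r, x)) σ) :=
      hv.continuous.comp (continuous_extendCurve _)
    have hd := (hcont.integral_hasStrictDerivAt 0 (τ / r)).hasDerivAt.scomp τ
      ((hasDerivAt_id τ).div_const r)
    have hd' := (hd.const_smul r).const_add x
    rw [smul_smul, mul_one_div_cancel hr.ne', one_smul, ← hval] at hd'
    refine hd'.congr_of_eventuallyEq ?_
    have hopen : ∀ᶠ t in 𝓝 τ, |t| < r := continuous_abs.continuousAt.eventually_lt_const hτ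
    filter_upwards [hopen] with t ht
    exact hev t ht

end Flow

/-! ### Local inverses, cutoffs and straightening -/

/-- The inverse function theorem for maps that are smooth near a point. -/
theorem exists_openPartialHomeomorph_contDiffAt {E F : Type*}
    [NormedAddCommGroup E] [NormedSpace ℝ E] [CompleteSpace E]
    [NormedAddCommGroup F] [NormedSpace ℝ F] {f : E → F} {a : E} (f' : E ≃L[ℝ] F)
    (hf : ∀ᶠ x in 𝓝 a, ContDiffAt ℝ ∞ f x) (hf' : HasFDerivAt f (f' : E →L[ℝ] F) a) :
    ∃ e : OpenPartialHomeomorph E F, a ∈ e.source ∧ (∀ x, e x = f x) ∧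
      (∀ x ∈ e.source, ContDiffAt ℝ ∞ f x) ∧ ∀ y ∈ e.target, ContDiffAt ℝ ∞ e.symm y := by
  have hfa := hf.self_of_nhds
  let e₀ := hfa.toOpenPartialHomeomorph f hf' (by simp)
  have hopen : IsOpen (Set.range ((↑) : (E ≃L[ℝ] F) → E →L[ℝ] F)) := ContinuousLinearEquiv.isOpen
  have hcont : ContinuousAt (fderiv ℝ f) a :=
    (hfa.fderiv_right (m := 0) (by simp)).continuousAt
  have hinv : ∀ᶠ x in 𝓝 a, fderiv ℝ f x ∈ Set.range ((↑) : (E ≃L[ℝ] F) → E →L[ℝ] F) :=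
    hcont.eventually_mem (hopen.mem_nhds ⟨f', hf'.fderiv.symm⟩)
  -- Restricting to `s`, where `f` is smooth with invertible derivative, makes the inverse smooth on
  -- the whole target.
  obtain ⟨s, hs, hso, has⟩ := eventually_nhds_iff.1 (hf.and hinv)
  refine ⟨e₀.restrOpen s hso, ⟨hfa.mem_toOpenPartialHomeomorph_source hf' (by simp), has⟩,
    fun x => rfl, fun x hx => (hs x hx.2).1, fun y hy => ?_⟩
  have hy' := (e₀.restrOpen s hso).map_target hy
  obtain ⟨L, hL⟩ := (hs _ hy'.2).2
  refine (e₀.restrOpen s hso).contDiffAt_symm (f₀' := L) hy ?_ (hs _ hy'.2).1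
  rw [hL]
  exact ((hs _ hy'.2).1.differentiableAt (by simp)).hasFDerivAt

/-- A map that is smooth near a point agrees near this point with a globally smooth map. -/
theorem exists_contDiff_eventuallyEq {E F : Type*}
    [NormedAddCommGroup E] [NormedSpace ℝ E] [FiniteDimensional ℝ E]
    [NormedAddCommGroup F] [NormedSpace ℝ F] {f : E → F} {a : E}
    (hf : ∀ᶠ x in 𝓝 a, ContDiffAt ℝ ∞ f x) :
    ∃ g : E → F, ContDiff ℝ ∞ g ∧ g =ᶠ[𝓝 a] f := by
  obtain ⟨r, hr, h⟩ := Metric.eventually_nhds_iff_ball.1 hf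
  let χ : ContDiffBump a := ⟨r / 4, r / 2, by positivity, by linarith⟩
  refine ⟨fun x => χ x • f x, ?_, ?_⟩
  · refine contDiff_iff_contDiffAt.2 fun x => ?_
    by_cases hx : x ∈ Metric.ball a r
    · exact χ.contDiff.contDiffAt.smul (h x hx)
    · refine contDiffAt_const (c := (0 : F)) |>.congr_of_eventuallyEq ?_
      have hx' : x ∈ (Metric.closedBall a (r / 2))ᶜ := by
        simp only [Metric.mem_ball, not_lt, Set.mem_compl_iff, Metric.mem_closedBall] at hx ⊢
        intro h'
        linarith
      filter_upwards [Metric.isClosed_closedBall.isOpen_compl.mem_nhds hx'] with y hy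
      have : χ y = 0 := by
        refine χ.zero_of_le_dist ?_
        simp only [Set.mem_compl_iff, Metric.mem_closedBall, not_le] at hy
        exact hy.le
      rw [this, zero_smul]
  · filter_upwards [χ.eventuallyEq_one] with x hx
    rw [hx]
    simp

/-- Straightening of a vector field: near a point where it does not vanish, there are coordinates
in which a smooth vector field is constant. -/
theorem exists_straightening.{u} {E : Type u} [NormedAddCommGroup E] [NormedSpace ℝ E]
    [FiniteDimensional ℝ E] {v : E → E} {x₀ : E} (hv : ∀ᶠ x in 𝓝 x₀, ContDiffAt ℝ ∞ v x)
    (hne : v x₀ ≠ 0) :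
    ∃ Θ : E → E, (∀ᶠ x in 𝓝 x₀, ContDiffAt ℝ ∞ Θ x) ∧ HasFDerivAt Θ (.id ℝ E) x₀ ∧
      ∀ᶠ x in 𝓝 x₀, fderiv ℝ Θ x (v x) = v x₀ := by
  have : CompleteSpace E := FiniteDimensional.complete ℝ E
  obtain ⟨g, hg, hgv⟩ := exists_contDiff_eventuallyEq hv
  obtain ⟨Φ, hΦ, hΦ₀, hΦ'⟩ := exists_contDiffAt_flow hg x₀
  obtain ⟨φ, hφ⟩ : ∃ φ : E →L[ℝ] ℝ, φ (v x₀) = 1 := by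
    obtain ⟨φ, hφ⟩ := SeparatingDual.exists_eq_one (R := ℝ) hne
    exact ⟨φ, hφ⟩
  -- `φ z` is the flow time; the other entry is the starting point on the hyperplane through `x₀`
  -- parallel to `ker φ`, transverse to `v x₀`. Moving `z` along `v x₀` changes only the time, so
  -- `Ψ` carries the constant field to `v`.
  let T : E → ℝ × E := fun z => (φ z, x₀ + (z - φ z • v x₀))
  have hT : ContDiff ℝ ∞ T := by fun_prop
  have hT₀ : T 0 = (0, x₀) := by simp [T]
  have hTt : Filter.Tendsto T (𝓝 0) (𝓝 (0, x₀)) := by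
    have := hT.continuous.tendsto 0
    rwa [hT₀] at this
  let Ψ : E → E := Φ ∘ T
  have hΨ : ∀ᶠ z in 𝓝 0, ContDiffAt ℝ ∞ Ψ z := by
    filter_upwards [hTt.eventually hΦ] with z hz
    exact hz.comp z hT.contDiffAt
  have hΨ₀ : Ψ 0 = x₀ := by
    simp only [Ψ, Function.comp_apply, hT₀]
    exact hΦ₀.self_of_nhds
  have hΨv : ∀ᶠ z in 𝓝 0, fderiv ℝ Ψ z (v x₀) = v (Ψ z) := by
    have hΨt : Filter.Tendsto Ψ (𝓝 0) (𝓝 x₀) := by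
      have := hΨ.self_of_nhds.continuousAt.tendsto
      rwa [hΨ₀] at this
    filter_upwards [hTt.eventually hΦ', hΨ, hΨt.eventually hgv] with z hz hz' hzg
    have h1 : HasDerivAt (fun t : ℝ => Ψ (z + t • v x₀)) (fderiv ℝ Ψ z (v x₀)) 0 := by
      have hl : HasDerivAt (fun t : ℝ => z + t • v x₀) (v x₀) 0 := by
        simpa using ((hasDerivAt_id (0 : ℝ)).smul_const (v x₀)).const_add z
      have hd := (hz'.differentiableAt (by simp)).hasFDerivAt
      have hd' : HasFDerivAt Ψ (fderiv ℝ Ψ z) (z + (0 : ℝ) • v x₀) := by simpa using hd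
      exact hd'.comp_hasDerivAt 0 hl
    have h2 : HasDerivAt (fun t : ℝ => Ψ (z + t • v x₀)) (g (Ψ z)) 0 := by
      have he : (fun t : ℝ => Ψ (z + t • v x₀)) = fun t => Φ (φ z + t, (T z).2) := by
        funext t
        simp only [Ψ, T, Function.comp_apply, map_add, map_smul, hφ, smul_eq_mul, mul_one, add_smul]
        congr 3
        abel
      rw [he]
      have hz0 : HasDerivAt (fun t => Φ (t, (T z).2)) (g (Ψ z)) (φ z + 0) := by
        rw [add_zero]
        exact hz
      exact hz0.comp_const_add (φ z) 0
    rw [h1.unique h2, hzg]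
  have hΨ' : HasFDerivAt Ψ (ContinuousLinearEquiv.refl ℝ E : E →L[ℝ] E) 0 := by
    have hd := (hΨ.self_of_nhds.differentiableAt (by simp)).hasFDerivAt
    convert hd using 1
    ext z
    -- On `ker φ` the flow time is zero and `Ψ y = x₀ + y` for small `y`; the remaining direction `v
    -- x₀` is covered by `hΨv`.
    have hker : fderiv ℝ Ψ 0 (z - φ z • v x₀) = z - φ z • v x₀ := by
      set y := z - φ z • v x₀ with hy
      have hφy : φ y = 0 := by simp [hy, hφ]
      have hl : HasDerivAt (fun t : ℝ => t • y) y 0 := by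
        simpa using (hasDerivAt_id (0 : ℝ)).smul_const y
      have hd' : HasFDerivAt Ψ (fderiv ℝ Ψ 0) ((0 : ℝ) • y) := by simpa using hd
      have h1 := hd'.comp_hasDerivAt 0 hl
      have h2 : HasDerivAt (fun t : ℝ => x₀ + t • y) y 0 := hl.const_add x₀
      refine h1.unique (h2.congr_of_eventuallyEq ?_)
      have ht : Filter.Tendsto (fun t : ℝ => x₀ + t • y) (𝓝 0) (𝓝 x₀) := by
        have := h2.continuousAt.tendsto
        simpa using this
      filter_upwards [ht.eventually hΦ₀] with t ht
      simpa [Ψ, T, hφy] using ht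
    have hv0 := hΨv.self_of_nhds
    rw [hΨ₀] at hv0
    rw [map_sub, map_smul, hv0] at hker
    simpa using (sub_left_inj.1 hker).symm
  obtain ⟨e, he0, he, hes, het⟩ := exists_openPartialHomeomorph_contDiffAt _ hΨ hΨ'
  have hx₀ : x₀ ∈ e.target := by
    rw [← hΨ₀, ← he]
    exact e.map_source he0
  have hsymm₀ : e.symm x₀ = 0 := by
    rw [← hΨ₀, ← he]
    exact e.left_inv he0
  have htarget : ∀ᶠ x in 𝓝 x₀, x ∈ e.target := e.open_target.mem_nhds hx₀
  have hcomp : ∀ x ∈ e.target, fderiv ℝ e.symm x ∘L fderiv ℝ Ψ (e.symm x) = .id ℝ E := by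
    intro x hx
    have hs := e.map_target hx
    have h1 : HasFDerivAt Ψ (fderiv ℝ Ψ (e.symm x)) (e.symm x) :=
      ((hes _ hs).differentiableAt (by simp)).hasFDerivAt
    have h2 : HasFDerivAt e.symm (fderiv ℝ e.symm x) (Ψ (e.symm x)) := by
      rw [← he, e.right_inv hx]
      exact ((het _ hx).differentiableAt (by simp)).hasFDerivAt
    refine (h2.comp _ h1).unique ((hasFDerivAt_id _).congr_of_eventuallyEq ?_)
    filter_upwards [e.open_source.mem_nhds hs] with z hz
    rw [Function.comp_apply, ← he, e.left_inv hz, id]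
  refine ⟨e.symm, htarget.mono het, ?_, ?_⟩
  · have h := hcomp x₀ hx₀
    rw [hsymm₀, hΨ'.fderiv] at h
    have hd := ((het _ hx₀).differentiableAt (by simp)).hasFDerivAt
    convert hd using 1
    rw [← h]
    rfl
  · have hst : Filter.Tendsto e.symm (𝓝 x₀) (𝓝 0) := by
      have := (het _ hx₀).continuousAt.tendsto
      rwa [hsymm₀] at this
    filter_upwards [htarget, hst.eventually hΨv] with x hx hxv
    rw [← he, e.right_inv hx] at hxv
    rw [← hxv]
    simpa using congrArg (fun L => L (v x₀)) (hcomp x hx)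

/-! ### Linear algebra of transversality -/

/-- Given a surjective linear map `A` and a vector outside its kernel, there is a complementary
surjective linear map vanishing on this vector. -/
theorem exists_complementary_clm {d k : ℕ} {E F : Type*}
    [NormedAddCommGroup E] [NormedSpace ℝ E] [FiniteDimensional ℝ E]
    [NormedAddCommGroup F] [NormedSpace ℝ F] [FiniteDimensional ℝ F]
    (hd : Module.finrank ℝ E = d) (hk : Module.finrank ℝ F = k)
    (A : E →L[ℝ] F) (hA : Function.Surjective A) {w : E} (hw : A w ≠ 0) :
    ∃ l : ℕ, d = k + l ∧ ∃ (B : E →L[ℝ] EuclideanSpace ℝ (Fin l))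
      (L : E ≃L[ℝ] F × EuclideanSpace ℝ (Fin l)), B w = 0 ∧ (L : E →L[ℝ] _) = A.prod B := by
  have hrank := A.toLinearMap.finrank_range_add_finrank_ker
  rw [LinearMap.range_eq_top.2 hA, finrank_top, hd, hk] at hrank
  refine ⟨_, hrank.symm, ?_⟩
  let K := A.toLinearMap.ker
  obtain ⟨C, hC⟩ := K.exists_isCompl
  let π : E →ₗ[ℝ] K := K.projectionOnto C hC
  let ι : K ≃ₗ[ℝ] EuclideanSpace ℝ (Fin (Module.finrank ℝ K)) :=
    LinearEquiv.ofFinrankEq _ _ (by simp)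
  obtain ⟨φ, hφ⟩ := SeparatingDual.exists_eq_one (R := ℝ) hw
  -- Since `φ (A w) = 1`, the rank-one correction makes `B₀ w = 0`; it vanishes on `ker A`, so there
  -- `B₀` is still the isomorphism `ι`.
  let B₀ : E →ₗ[ℝ] EuclideanSpace ℝ (Fin (Module.finrank ℝ K)) :=
    ι.toLinearMap ∘ₗ (π - ((φ : F →ₗ[ℝ] ℝ) ∘ₗ A.toLinearMap).smulRight (π w))
  let B : E →L[ℝ] EuclideanSpace ℝ (Fin (Module.finrank ℝ K)) := B₀.toContinuousLinearMap
  have hB : ∀ x, B x = ι (π x - φ (A x) • π w) := fun x => rfl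
  have hinj : Function.Injective (A.prod B) := by
    refine (injective_iff_map_eq_zero _).2 fun x hx => ?_
    have h1 : A x = 0 := congrArg Prod.fst hx
    have h2 : B x = 0 := congrArg Prod.snd hx
    rw [hB, h1, map_zero, zero_smul, sub_zero, LinearEquiv.map_eq_zero_iff] at h2
    have h3 := Submodule.projectionOnto_apply_left hC ⟨x, h1⟩
    change π x = _ at h3
    rw [h2] at h3
    exact (congrArg Subtype.val h3).symm
  let L₀ := LinearEquiv.ofInjectiveOfFinrankEq (A.prod B).toLinearMap hinj
    (by rw [Module.finrank_prod, hd, hk, finrank_euclideanSpace_fin, hrank])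
  refine ⟨B, L₀.toContinuousLinearEquiv, by simp [hB, hφ], ?_⟩
  ext x <;> rfl

/-! ### Open submanifolds and restricted fields -/

/-- The differential of the inclusion of an open submanifold is invertible. -/
theorem TopologicalSpace.Opens.isInvertible_mfderiv_val {d : ℕ} {M : Type*} [TopologicalSpace M]
    [ChartedSpace (EuclideanSpace ℝ (Fin d)) M] [IsManifold (𝓡 d) ∞ M]
    (U : TopologicalSpace.Opens M) (u : U) :
    (mfderiv (𝓡 d) (𝓡 d) (Subtype.val : U → M) u).IsInvertible := by
  classical
  -- A two-sided inverse of the inclusion near `u`; the default value off `U` does not affect the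
  -- germ.
  let r : M → U := fun x => if hx : x ∈ U then ⟨x, hx⟩ else u
  have hr : ∀ x : U, r x = x := fun x => by simp [r]
  have hval : MDifferentiableAt (𝓡 d) (𝓡 d) (Subtype.val : U → M) u :=
    (contMDiff_subtype_val (n := ∞)).mdifferentiableAt (by simp)
  have hrd : MDifferentiableAt (𝓡 d) (𝓡 d) r (u : M) := by
    have h : ContMDiffAt (𝓡 d) (𝓡 d) ∞ r (u : M) := by
      rw [← contMDiffAt_subtype_iff]
      simp only [hr]
      exact contMDiffAt_id
    exact h.mdifferentiableAt (by simp)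
  have hrd' : MDifferentiableAt (𝓡 d) (𝓡 d) (Subtype.val : U → M) (r (u : M)) := by
    rw [hr]; exact hval
  have h1 : mfderiv (𝓡 d) (𝓡 d) (r ∘ (Subtype.val : U → M)) u
      = ContinuousLinearMap.id ℝ (TangentSpace (𝓡 d) u) := by
    have : r ∘ (Subtype.val : U → M) = id := funext hr
    rw [this]
    exact mfderiv_id
  have h2 : mfderiv (𝓡 d) (𝓡 d) ((Subtype.val : U → M) ∘ r) (u : M)
      = ContinuousLinearMap.id ℝ (TangentSpace (𝓡 d) (u : M)) := by
    rw [← mfderiv_id (I := 𝓡 d) (x := (u : M))]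
    refine Filter.EventuallyEq.mfderiv_eq ?_
    filter_upwards [U.isOpen.mem_nhds u.2] with x hx
    exact congrArg Subtype.val (hr ⟨x, hx⟩)
  rw [mfderiv_comp (I' := 𝓡 d) u hrd hval] at h1
  rw [mfderiv_comp (I' := 𝓡 d) (u : M) hrd' hrd] at h2
  rw [hr] at h2
  exact .of_inverse h2 h1

/-- The restriction of a vector field to an open submanifold is related to the vector field by the
inclusion. -/
theorem HamiltonJacobi.mfderiv_val_restrictField {d : ℕ} {M : Type*} [TopologicalSpace M]
    [ChartedSpace (EuclideanSpace ℝ (Fin d)) M] [IsManifold (𝓡 d) ∞ M]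
    (X : ∀ m : M, TangentSpace (𝓡 d) m) (U : TopologicalSpace.Opens M) (u : U) :
    mfderiv (𝓡 d) (𝓡 d) (Subtype.val : U → M) u (restrictField X U u) = X u := by
  exact (U.isInvertible_mfderiv_val u).self_apply_inverse _

/-! ### From first integrals to complete solutions -/

/-- Two maps into a product with the same first component have the same differential along a vector
on which the differential of the second components vanishes. -/
theorem tangentMap_prodMk_eq_of_mfderiv_eq_zero {d k l : ℕ}
    {M : Type*} [TopologicalSpace M] [ChartedSpace (EuclideanSpace ℝ (Fin d)) M]
    {N : Type*} [TopologicalSpace N] [ChartedSpace (EuclideanSpace ℝ (Fin k)) N]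
    {L : Type*} [TopologicalSpace L] [ChartedSpace (EuclideanSpace ℝ (Fin l)) L]
    {f : M → N} {g : M → L} {w : TangentBundle (𝓡 d) M}
    (hf : MDifferentiableAt (𝓡 d) (𝓡 k) f w.proj) (hg : MDifferentiableAt (𝓡 d) (𝓡 l) g w.proj)
    (h : mfderiv (𝓡 d) (𝓡 l) g w.proj w.snd = 0) :
    tangentMap (𝓡 d) ((𝓡 k).prod (𝓡 l)) (fun x => (f x, g w.proj)) w
      = tangentMap (𝓡 d) ((𝓡 k).prod (𝓡 l)) (fun x => (f x, g x)) w := by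
  have h1 := mfderiv_prodMk hf (mdifferentiableAt_const (I := 𝓡 d) (I' := 𝓡 l) (c := g w.proj))
  have h2 := mfderiv_prodMk hf hg
  refine congrArg (Bundle.TotalSpace.mk (f w.proj, g w.proj)) ?_
  rw [h1, h2, mfderiv_const]
  exact Prod.ext rfl h.symm

/-- A submersion straightened together with a family of first integrals of a vector field gives a
complete solution of the Hamilton-Jacobi equation. -/
theorem HamiltonJacobi.exists_isCompleteSolution {d k l : ℕ}
    {M : Type*} [TopologicalSpace M] [ChartedSpace (EuclideanSpace ℝ (Fin d)) M]
    [IsManifold (𝓡 d) ∞ M]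
    {N : Type*} [TopologicalSpace N] [ChartedSpace (EuclideanSpace ℝ (Fin k)) N]
    [IsManifold (𝓡 k) ∞ N]
    {P : M → N} (hP : IsFibration d k P) (X : ∀ m : M, TangentSpace (𝓡 d) m)
    (U : TopologicalSpace.Opens M) (V : Set N)
    (Λ : TopologicalSpace.Opens (EuclideanSpace ℝ (Fin l)))
    (Q : M → EuclideanSpace ℝ (Fin l)) (S : N × EuclideanSpace ℝ (Fin l) → M)
    (hU : ∀ u ∈ U, P u ∈ V ∧ Q u ∈ Λ ∧ S (P u, Q u) = u)
    (hV : ∀ n ∈ V, ∀ a ∈ Λ, S (n, a) ∈ U ∧ P (S (n, a)) = n ∧ Q (S (n, a)) = a)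
    (hQ : ∀ u ∈ U, ContMDiffAt (𝓡 d) (𝓡 l) ∞ Q u)
    (hS : ∀ n ∈ V, ∀ a ∈ Λ, ContMDiffAt ((𝓡 k).prod (𝓡 l)) (𝓡 d) ∞ S (n, a))
    (hQX : ∀ u ∈ U, mfderiv (𝓡 d) (𝓡 l) Q u (X u) = 0) :
    ∃ T : hP.image U × Λ → U,
      IsCompleteSolution d k l (hP.restrict U) (restrictField X U) T := by
  have himage : ∀ n ∈ hP.image U, n ∈ V := by
    rintro _ ⟨u, hu, rfl⟩
    exact (hU u hu).1
  let T : hP.image U × Λ → U := fun x => ⟨S (x.1, x.2), (hV _ (himage _ x.1.2) _ x.2.2).1⟩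
  let Pr : U → hP.image U := hP.restrict U
  let Qr : U → Λ := fun u => ⟨Q u, (hU u u.2).2.1⟩
  have hT : ContMDiff ((𝓡 k).prod (𝓡 l)) (𝓡 d) ∞ T := by
    rw [← ContMDiff.subtypeVal_comp_iff]
    intro x
    exact ContMDiffAt.comp (g := S) (f := Prod.map Subtype.val Subtype.val) x
      (hS _ (himage _ x.1.2) _ x.2.2) ((contMDiff_subtype_val.prodMap contMDiff_subtype_val) x)
  have hPr : ContMDiff (𝓡 d) (𝓡 k) ∞ Pr := by
    rw [← ContMDiff.subtypeVal_comp_iff]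
    exact hP.contMDiff.comp contMDiff_subtype_val
  have hQr : ContMDiff (𝓡 d) (𝓡 l) ∞ Qr := by
    rw [← ContMDiff.subtypeVal_comp_iff]
    intro u
    exact ContMDiffAt.comp (g := Q) (f := Subtype.val) u (hQ u u.2) (contMDiff_subtype_val u)
  have hleft : ∀ u, T (Pr u, Qr u) = u := fun u => Subtype.ext (hU u u.2).2.2
  have hright₁ : ∀ x, Pr (T x) = x.1 :=
    fun x => Subtype.ext (hV _ (himage _ x.1.2) _ x.2.2).2.1
  have hright₂ : ∀ x, Qr (T x) = x.2 :=
    fun x => Subtype.ext (hV _ (himage _ x.1.2) _ x.2.2).2.2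
  let D : Diffeomorph ((𝓡 k).prod (𝓡 l)) (𝓡 d) (hP.image U × Λ) U ∞ :=
    { toFun := T
      invFun := fun u => (Pr u, Qr u)
      left_inv := fun x => Prod.ext (hright₁ x) (hright₂ x)
      right_inv := hleft
      contMDiff_toFun := hT
      contMDiff_invFun := hPr.prodMk hQr }
  have hQrX : ∀ u, mfderiv (𝓡 d) (𝓡 l) Qr u (restrictField X U u) = 0 := by
    intro u
    have hQrd : MDifferentiableAt (𝓡 d) (𝓡 l) Qr u := hQr.mdifferentiableAt (by simp)
    have hQd : MDifferentiableAt (𝓡 d) (𝓡 l) Q (u : M) :=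
      (hQ u u.2).mdifferentiableAt (by simp)
    have h1 : mfderiv (𝓡 d) (𝓡 l) ((Subtype.val : Λ → _) ∘ Qr) u
        = mfderiv (𝓡 d) (𝓡 l) (Q ∘ (Subtype.val : U → M)) u := rfl
    rw [mfderiv_comp (I' := 𝓡 l) u ((contMDiff_subtype_val (n := ∞)).mdifferentiableAt (by simp))
        hQrd,
      mfderiv_comp (I' := 𝓡 d) u hQd
        ((contMDiff_subtype_val (n := ∞)).mdifferentiableAt (by simp))] at h1
    have h2 := congrArg (fun L => L (restrictField X U u)) h1
    have h3 : mfderiv (𝓡 l) (𝓡 l) (Subtype.val : Λ → _) (Qr u)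
        (mfderiv (𝓡 d) (𝓡 l) Qr u (restrictField X U u)) = 0 := by
      refine h2.trans ?_
      refine (congrArg (mfderiv (𝓡 d) (𝓡 l) Q (u : M))
        (mfderiv_val_restrictField X U u)).trans (hQX u u.2)
    exact (Λ.isInvertible_mfderiv_val (Qr u)).injective (h3.trans (map_zero _).symm)
  refine ⟨T, fun u => ⟨_, hleft u⟩, D.isLocalDiffeomorph, fun a => ⟨?_, ?_, ?_⟩⟩
  · exact hT.comp (contMDiff_id.prodMk contMDiff_const)
  · funext n
    exact hright₁ (n, a)
  · funext n
    set u : U := T (n, a) with hu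
    have hs : ContMDiff (𝓡 k) (𝓡 d) ∞ (fun n => T (n, a)) :=
      hT.comp (contMDiff_id.prodMk contMDiff_const)
    have hH : ContMDiff (𝓡 d) ((𝓡 k).prod (𝓡 l)) ∞ (fun u => (Pr u, Qr u)) := hPr.prodMk hQr
    have hH' : ContMDiff (𝓡 d) ((𝓡 k).prod (𝓡 l)) ∞ (fun u => (Pr u, a)) :=
      hPr.prodMk contMDiff_const
    have hPrd : MDifferentiableAt (𝓡 d) (𝓡 k) Pr u := hPr.mdifferentiableAt (by simp)
    have hQrd : MDifferentiableAt (𝓡 d) (𝓡 l) Qr u := hQr.mdifferentiableAt (by simp)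
    have hTd : MDifferentiable ((𝓡 k).prod (𝓡 l)) (𝓡 d) T := hT.mdifferentiable (by simp)
    -- By the chain rule the left side of the HJE is `T ∘ (Pr, a)` applied to `X`. At `u = T (n, a)`
    -- one has `a = Qr u`, and `Qr` has zero derivative along `X`, so `a` may be replaced by `Qr`,
    -- giving the identity.
    have e1 : tangentMap (𝓡 k) (𝓡 d) (fun n => T (n, a))
        (tangentMap (𝓡 d) (𝓡 k) Pr (fieldMap (restrictField X U) u))
        = tangentMap (𝓡 d) (𝓡 d) (T ∘ fun u => (Pr u, a)) (fieldMap (restrictField X U) u) :=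
      (tangentMap_comp_at (fieldMap (restrictField X U) u) (hs.mdifferentiableAt (by simp))
        hPrd).symm
    have e2 : tangentMap (𝓡 d) ((𝓡 k).prod (𝓡 l)) (fun u => (Pr u, a))
          (fieldMap (restrictField X U) u)
        = tangentMap (𝓡 d) ((𝓡 k).prod (𝓡 l)) (fun u => (Pr u, Qr u))
          (fieldMap (restrictField X U) u) := by
      have ha : a = Qr (fieldMap (restrictField X U) u).proj := (hright₂ (n, a)).symm
      rw [ha]
      exact tangentMap_prodMk_eq_of_mfderiv_eq_zero hPrd hQrd (hQrX u)
    have e3 : tangentMap (𝓡 d) (𝓡 d) (T ∘ fun u => (Pr u, Qr u)) (fieldMap (restrictField X U) u)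
        = fieldMap (restrictField X U) u := by
      have : (T ∘ fun u => (Pr u, Qr u)) = id := funext hleft
      rw [this, tangentMap_id]
      rfl
    refine e1.trans ?_
    rw [tangentMap_comp_at _ (hTd _) (hH'.mdifferentiableAt (by simp)), e2,
      ← tangentMap_comp_at _ (hTd _) (hH.mdifferentiableAt (by simp)), e3]
    rfl

/-! ### Vector fields and fibrations in charts -/

section ExtChart

variable {d : ℕ} {M : Type*} [TopologicalSpace M] [ChartedSpace (EuclideanSpace ℝ (Fin d)) M]
  [IsManifold (𝓡 d) ∞ M]

theorem contMDiffAt_extChartAt_symm_of_mem (m : M) {x : EuclideanSpace ℝ (Fin d)}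
    (hx : x ∈ (extChartAt (𝓡 d) m).target) :
    ContMDiffAt 𝓘(ℝ, EuclideanSpace ℝ (Fin d)) (𝓡 d) ∞ (extChartAt (𝓡 d) m).symm x :=
  (contMDiffOn_extChartAt_symm m).contMDiffAt ((isOpen_extChartAt_target m).mem_nhds hx)

theorem isInvertible_mfderiv_extChartAt_symm_of_mem (m : M) {x : EuclideanSpace ℝ (Fin d)}
    (hx : x ∈ (extChartAt (𝓡 d) m).target) :
    (mfderiv 𝓘(ℝ, EuclideanSpace ℝ (Fin d)) (𝓡 d) (extChartAt (𝓡 d) m).symm x).IsInvertible := by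
  have : IsManifold (𝓡 d) 1 M := .of_le (n := ∞) (by simp)
  have h := isInvertible_mfderivWithin_extChartAt_symm (I := 𝓡 d) hx
  rwa [ModelWithCorners.range_eq_univ, mfderivWithin_univ] at h

/-- A vector field read in a chart. -/
noncomputable def fieldInChart (X : ∀ m : M, TangentSpace (𝓡 d) m) (m : M) :
    EuclideanSpace ℝ (Fin d) → EuclideanSpace ℝ (Fin d) :=
  VectorField.mpullback 𝓘(ℝ, EuclideanSpace ℝ (Fin d)) (𝓡 d) (extChartAt (𝓡 d) m).symm X

theorem mfderiv_fieldInChart (X : ∀ m : M, TangentSpace (𝓡 d) m) (m : M)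
    {x : EuclideanSpace ℝ (Fin d)} (hx : x ∈ (extChartAt (𝓡 d) m).target) :
    mfderiv 𝓘(ℝ, EuclideanSpace ℝ (Fin d)) (𝓡 d) (extChartAt (𝓡 d) m).symm x
      (fieldInChart X m x) = X ((extChartAt (𝓡 d) m).symm x) :=
  (isInvertible_mfderiv_extChartAt_symm_of_mem m hx).self_apply_inverse _

/-- The tangent space at `m` is identified with the model through the preferred chart, whose inverse
thus has identity differential there. Transversality of `X m` then transfers verbatim to the chart.
-/
theorem fieldInChart_apply_self (X : ∀ m : M, TangentSpace (𝓡 d) m) (m : M) :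
    fieldInChart X m (extChartAt (𝓡 d) m m) = X m := by
  have : IsManifold (𝓡 d) 1 M := .of_le (n := ∞) (by simp)
  have hid := mfderivWithin_range_extChartAt_symm (I := 𝓡 d) (x := m)
  rw [ModelWithCorners.range_eq_univ, mfderivWithin_univ] at hid
  have h := mfderiv_fieldInChart X m (mem_extChartAt_target m)
  rw [hid] at h
  exact Eq.trans h (congrArg (fun y => (X y : EuclideanSpace ℝ (Fin d))) (extChartAt_to_inv m))

theorem contDiffAt_fieldInChart {X : ∀ m : M, TangentSpace (𝓡 d) m}
    (hX : ContMDiff (𝓡 d) (𝓡 d).tangent ∞ (HamiltonJacobi.fieldMap X)) (m : M)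
    {x : EuclideanSpace ℝ (Fin d)} (hx : x ∈ (extChartAt (𝓡 d) m).target) :
    ContDiffAt ℝ ∞ (fieldInChart X m) x := by
  rw [← contMDiffAt_vectorSpace_iff_contDiffAt (V := fieldInChart X m)]
  exact ContMDiffAt.mpullback_vectorField_preimage (n := ∞) (hX _)
    (contMDiffAt_extChartAt_symm_of_mem m hx)
    (isInvertible_mfderiv_extChartAt_symm_of_mem m hx) (by simp)

end ExtChart

/-- The differential of a fibration read in charts. -/
theorem HamiltonJacobi.IsFibration.fderiv_writtenInExtChartAt_apply {d k : ℕ}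
    {M : Type*} [TopologicalSpace M] [ChartedSpace (EuclideanSpace ℝ (Fin d)) M]
    {N : Type*} [TopologicalSpace N] [ChartedSpace (EuclideanSpace ℝ (Fin k)) N]
    {P : M → N} (hP : HamiltonJacobi.IsFibration d k P) (m : M)
    (w : EuclideanSpace ℝ (Fin d)) :
    fderiv ℝ (writtenInExtChartAt (𝓡 d) (𝓡 k) m P) (extChartAt (𝓡 d) m m) w
      = mfderiv (𝓡 d) (𝓡 k) P m w := by
  rw [((hP.contMDiff m).mdifferentiableAt (by simp)).mfderiv]
  simp only [ModelWithCorners.range_eq_univ, fderivWithin_univ]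
  rfl

/-! ### Construction of the first integrals -/

namespace HamiltonJacobi

variable {d k : ℕ}
  {M : Type*} [TopologicalSpace M] [ChartedSpace (EuclideanSpace ℝ (Fin d)) M]
  [IsManifold (𝓡 d) ∞ M]
  {N : Type*} [TopologicalSpace N] [ChartedSpace (EuclideanSpace ℝ (Fin k)) N]
  [IsManifold (𝓡 k) ∞ N]

/-- A fibration read in charts is smooth. -/
theorem IsFibration.contDiffAt_writtenInExtChartAt {P : M → N} (hP : IsFibration d k P) (m : M)
    {x : EuclideanSpace ℝ (Fin d)} (hx : x ∈ (extChartAt (𝓡 d) m).target)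
    (hPx : P ((extChartAt (𝓡 d) m).symm x) ∈ (extChartAt (𝓡 k) (P m)).source) :
    ContDiffAt ℝ ∞ (writtenInExtChartAt (𝓡 d) (𝓡 k) m P) x := by
  rw [← contMDiffAt_iff_contDiffAt]
  rw [extChartAt_source] at hPx
  exact (contMDiffAt_extChartAt' hPx).comp x
    ((hP.contMDiff _).comp x (contMDiffAt_extChartAt_symm_of_mem m hx))

/-- Near a point where a vector field is transverse to the fibres of a fibration, there are
coordinates on the fibres which are first integrals of the vector field. -/
theorem IsFibration.exists_firstIntegrals {P : M → N} (hP : IsFibration d k P)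
    {X : ∀ m : M, TangentSpace (𝓡 d) m}
    (hX : ContMDiff (𝓡 d) (𝓡 d).tangent ∞ (fieldMap X))
    (m : M) (hm : X m ∉ (mfderiv (𝓡 d) (𝓡 k) P m).ker) :
    ∃ l : ℕ, d = k + l ∧ ∃ (U : TopologicalSpace.Opens M) (V : Set N)
      (Λ : TopologicalSpace.Opens (EuclideanSpace ℝ (Fin l)))
      (Q : M → EuclideanSpace ℝ (Fin l)) (S : N × EuclideanSpace ℝ (Fin l) → M), m ∈ U ∧
      (∀ u ∈ U, P u ∈ V ∧ Q u ∈ Λ ∧ S (P u, Q u) = u) ∧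
      (∀ n ∈ V, ∀ a ∈ Λ, S (n, a) ∈ U ∧ P (S (n, a)) = n ∧ Q (S (n, a)) = a) ∧
      (∀ u ∈ U, ContMDiffAt (𝓡 d) (𝓡 l) ∞ Q u) ∧
      (∀ n ∈ V, ∀ a ∈ Λ, ContMDiffAt ((𝓡 k).prod (𝓡 l)) (𝓡 d) ∞ S (n, a)) ∧
      ∀ u ∈ U, mfderiv (𝓡 d) (𝓡 l) Q u (X u) = 0 := by
  set φ := extChartAt (𝓡 d) m with hφ
  set ψ := extChartAt (𝓡 k) (P m) with hψ
  set v := fieldInChart X m with hv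
  set p := writtenInExtChartAt (𝓡 d) (𝓡 k) m P with hp
  set x₀ := φ m with hx₀
  have hx₀t : x₀ ∈ φ.target := mem_extChartAt_target m
  have hsymm₀ : φ.symm x₀ = m := extChartAt_to_inv m
  have htarget : ∀ᶠ x in 𝓝 x₀, x ∈ φ.target := (isOpen_extChartAt_target m).mem_nhds hx₀t
  have hφsc : ContinuousAt φ.symm x₀ := (contMDiffAt_extChartAt_symm_of_mem m hx₀t).continuousAt
  have hPsource : ∀ᶠ x in 𝓝 x₀, P (φ.symm x) ∈ ψ.source := by
    have hc : ContinuousAt (fun x => P (φ.symm x)) x₀ :=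
      hP.contMDiff.continuous.continuousAt.comp hφsc
    refine hc.eventually_mem ?_
    rw [hsymm₀]
    exact extChartAt_source_mem_nhds (P m)
  have hvx₀ : v x₀ = X m := fieldInChart_apply_self X m
  have hAv : fderiv ℝ p x₀ (v x₀) ≠ 0 := by
    rw [hP.fderiv_writtenInExtChartAt_apply, hvx₀]
    exact hm
  have hAsurj : Function.Surjective (fderiv ℝ p x₀) := by
    intro y
    obtain ⟨w, hw⟩ := hP.surjective_mfderiv m y
    exact ⟨w, (hP.fderiv_writtenInExtChartAt_apply m w).trans hw⟩
  obtain ⟨l, hl, B, L, hBv, hL⟩ := exists_complementary_clm (d := d) (k := k) (by simp) (by simp)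
    (fderiv ℝ p x₀) hAsurj hAv
  have hvne : v x₀ ≠ 0 := by
    intro h
    rw [h, map_zero] at hAv
    exact hAv rfl
  obtain ⟨Θ, hΘ, hΘ', hΘv⟩ := exists_straightening
    (htarget.mono fun x hx => contDiffAt_fieldInChart hX m hx) hvne
  -- `Θ` makes the field constant and `B` kills that constant. As `Θ` has identity derivative at
  -- `x₀`, the derivative of `(p, q)` there is exactly `L`.
  let q : EuclideanSpace ℝ (Fin d) → EuclideanSpace ℝ (Fin l) := fun x => B (Θ x)
  have hq : ∀ᶠ x in 𝓝 x₀, ContDiffAt ℝ ∞ q x :=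
    hΘ.mono fun x hx => B.contDiff.contDiffAt.comp x hx
  have hq' : HasFDerivAt q B x₀ := by
    have h := B.hasFDerivAt.comp x₀ hΘ'
    rwa [ContinuousLinearMap.comp_id] at h
  have hqv : ∀ᶠ x in 𝓝 x₀, fderiv ℝ q x (v x) = 0 := by
    filter_upwards [hΘ, hΘv] with x hx hxv
    have h : HasFDerivAt q (B ∘L fderiv ℝ Θ x) x :=
      B.hasFDerivAt.comp x (hx.differentiableAt (by simp)).hasFDerivAt
    rw [h.fderiv, ContinuousLinearMap.comp_apply, hxv, hBv]
  have hpsmooth : ∀ᶠ x in 𝓝 x₀, ContDiffAt ℝ ∞ p x := by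
    filter_upwards [htarget, hPsource] with x hx hPx
    exact hP.contDiffAt_writtenInExtChartAt m hx hPx
  obtain ⟨e, hex₀, he, hes, het⟩ := exists_openPartialHomeomorph_contDiffAt (a := x₀)
    (f := fun x => (p x, q x)) L
    ((hpsmooth.and hq).mono fun x hx => hx.1.prodMk hx.2)
    (by
      rw [hL]
      exact (hpsmooth.self_of_nhds.differentiableAt (by simp)).hasFDerivAt.prodMk hq')
  obtain ⟨A, hA, hAo, hx₀A⟩ := eventually_nhds_iff.1 (htarget.and (hPsource.and (hq.and hqv)))
  -- the domain, in the product, of the inverse of the adapted coordinates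
  let W : Set (N × EuclideanSpace ℝ (Fin l)) :=
    {y | y.1 ∈ ψ.source ∧ (ψ y.1, y.2) ∈ e.target ∧ e.symm (ψ y.1, y.2) ∈ A}
  have hpx₀ : p x₀ = ψ (P m) := by
    simp [hp, writtenInExtChartAt, hx₀, hφ, hψ]
  have hW : W ∈ 𝓝 (P m, q x₀) := by
    have hc : ContinuousAt (fun y : N × EuclideanSpace ℝ (Fin l) => (ψ y.1, y.2)) (P m, q x₀) :=
      ContinuousAt.prodMk
        (ContinuousAt.comp (f := Prod.fst) (continuousAt_extChartAt (P m)) continuousAt_fst)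
        continuousAt_snd
    have he₀ : e x₀ = (ψ (P m), q x₀) := by rw [he, hpx₀]
    have ht₀ : (ψ (P m), q x₀) ∈ e.target := he₀ ▸ e.map_source hex₀
    have h1 : ∀ᶠ z in 𝓝 (ψ (P m), q x₀), z ∈ e.target ∧ e.symm z ∈ A := by
      refine (e.open_target.eventually_mem ht₀).and ?_
      refine (e.symm.continuousAt ht₀).eventually_mem (hAo.mem_nhds ?_)
      rw [← he₀, e.left_inv hex₀]
      exact hx₀A
    filter_upwards [continuousAt_fst.eventually_mem (extChartAt_source_mem_nhds (I := 𝓡 k) (P m)),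
      hc.eventually h1] with y hy1 hy2
    exact ⟨hy1, hy2⟩
  rw [nhds_prod_eq, Filter.mem_prod_iff] at hW
  obtain ⟨V₁, hV₁, Λ₁, hΛ₁, hVΛ⟩ := hW
  obtain ⟨V, hVV, hVo, hmV⟩ := mem_nhds_iff.1 hV₁
  obtain ⟨Λ, hΛΛ, hΛo, hmΛ⟩ := mem_nhds_iff.1 hΛ₁
  have hbox : ∀ n ∈ V, ∀ a ∈ Λ, (n, a) ∈ W := fun n hn a ha => hVΛ ⟨hVV hn, hΛΛ ha⟩
  let Q : M → EuclideanSpace ℝ (Fin l) := fun u => q (φ u)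
  let S : N × EuclideanSpace ℝ (Fin l) → M := fun y => φ.symm (e.symm (ψ y.1, y.2))
  -- Requiring `(P, Q)` to land in the box `V × Λ`, which lies inside `W`, makes `(P, Q)` a
  -- bijection from `G` onto the whole box with inverse `S`.
  let G : Set M := {u | u ∈ φ.source ∧ φ u ∈ A ∩ e.source ∧ P u ∈ V ∧ Q u ∈ Λ}
  have hφsource : ∀ u ∈ φ.source, ContMDiffAt (𝓡 d) 𝓘(ℝ, EuclideanSpace ℝ (Fin d)) ∞ φ u :=
    fun u hu => contMDiffAt_extChartAt' (by rwa [hφ, extChartAt_source] at hu)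
  have hQ : ∀ u ∈ φ.source, φ u ∈ A → ContMDiffAt (𝓡 d) (𝓡 l) ∞ Q u := fun u hu huA =>
    ContMDiffAt.comp (g := q) (f := φ) u (hA _ huA).2.2.1.contMDiffAt (hφsource u hu)
  have hGo : IsOpen G := by
    rw [isOpen_iff_mem_nhds]
    rintro u ⟨hu1, hu2, hu3, hu4⟩
    have hφc : ContinuousAt φ u := (hφsource u hu1).continuousAt
    filter_upwards [(isOpen_extChartAt_source m).mem_nhds hu1,
      hφc.eventually_mem ((hAo.inter e.open_source).mem_nhds hu2),
      hP.contMDiff.continuous.continuousAt.eventually_mem (hVo.mem_nhds hu3),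
      (hQ u hu1 hu2.1).continuousAt.eventually_mem (hΛo.mem_nhds hu4)] with w h1 h2 h3 h4
    exact ⟨h1, h2, h3, h4⟩
  refine ⟨l, hl, ⟨G, hGo⟩, V, ⟨Λ, hΛo⟩, Q, S, ?_, ?_, ?_, ?_, ?_, ?_⟩
  · exact ⟨mem_extChartAt_source m, ⟨hx₀A, hex₀⟩, hmV, hmΛ⟩
  · rintro u ⟨hu1, hu2, hu3, hu4⟩
    refine ⟨hu3, hu4, ?_⟩
    have h : e (φ u) = (ψ (P u), Q u) := by
      rw [he]
      simp only [hp, writtenInExtChartAt, Function.comp_apply, Q]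
      rw [← hφ, φ.left_inv hu1]
    change φ.symm (e.symm (ψ (P u), Q u)) = u
    rw [← h, e.left_inv hu2.2, φ.left_inv hu1]
  · intro n hn a ha
    obtain ⟨h1, h2, h3⟩ := hbox n hn a ha
    obtain ⟨hyt, hyP, -, -⟩ := hA _ h3
    have hφS : φ (S (n, a)) = e.symm (ψ n, a) := φ.right_inv hyt
    have heS := e.right_inv h2
    rw [he] at heS
    -- `e` only controls `ψ (P ·)`; the condition on `A` that `P` stays in the chart domain allows
    -- `ψ` to be cancelled.
    have hPS : P (S (n, a)) = n := ψ.injOn hyP h1 (congrArg Prod.fst heS)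
    have hQS : Q (S (n, a)) = a := by
      change q (φ (S (n, a))) = a
      rw [hφS]
      exact congrArg Prod.snd heS
    refine ⟨⟨φ.map_target hyt, ?_, ?_, ?_⟩, hPS, hQS⟩
    · rw [hφS]
      exact ⟨h3, e.map_target h2⟩
    · rwa [hPS]
    · rwa [hQS]
  · exact fun u hu => hQ u hu.1 hu.2.1.1
  · intro n hn a ha
    obtain ⟨h1, h2, h3⟩ := hbox n hn a ha
    have hψn : ContMDiffAt (𝓡 k) 𝓘(ℝ, EuclideanSpace ℝ (Fin k)) ∞ ψ n :=
      contMDiffAt_extChartAt' (by rwa [hψ, extChartAt_source] at h1)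
    have hc1 : ContMDiffAt ((𝓡 k).prod (𝓡 l))
        𝓘(ℝ, EuclideanSpace ℝ (Fin k) × EuclideanSpace ℝ (Fin l)) ∞
        (fun y : N × EuclideanSpace ℝ (Fin l) => (ψ y.1, y.2)) (n, a) :=
      (ContMDiffAt.comp (f := Prod.fst) (n, a) hψn contMDiffAt_fst).prodMk_space contMDiffAt_snd
    exact ContMDiffAt.comp (n, a) (contMDiffAt_extChartAt_symm_of_mem m (hA _ h3).1)
      (ContMDiffAt.comp (n, a) (het _ h2).contMDiffAt hc1)
  · rintro u ⟨hu1, hu2, -, -⟩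
    have hut : φ u ∈ φ.target := φ.map_source hu1
    have hus : φ.symm (φ u) = u := φ.left_inv hu1
    have hXu := mfderiv_fieldInChart X m hut
    have hQd : MDifferentiableAt (𝓡 d) (𝓡 l) Q (φ.symm (φ u)) := by
      rw [hus]
      exact (hQ u hu1 hu2.1).mdifferentiableAt (by simp)
    have hcomp := mfderiv_comp_apply (I' := 𝓡 d) (φ u) hQd
      ((contMDiffAt_extChartAt_symm_of_mem m hut).mdifferentiableAt (by simp)) (v (φ u))
    have hzero : mfderiv 𝓘(ℝ, EuclideanSpace ℝ (Fin d)) (𝓡 l) (Q ∘ φ.symm) (φ u) (v (φ u)) = 0 := by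
      have heq : Q ∘ φ.symm =ᶠ[𝓝 (φ u)] q := by
        filter_upwards [(isOpen_extChartAt_target m).mem_nhds hut] with x hx
        exact congrArg q (φ.right_inv hx)
      rw [heq.mfderiv_eq, mfderiv_eq_fderiv]
      exact (hA _ hu2.1).2.2.2
    have hfin : mfderiv (𝓡 d) (𝓡 l) Q (φ.symm (φ u)) (X (φ.symm (φ u))) = 0 := by
      rw [← hXu]
      exact hcomp.symm.trans hzero
    rwa [hus] at hfin

end HamiltonJacobi

/-! ### The main theorem -/

theorem mainTheorem10 {d k : ℕ}
    {M : Type*} [TopologicalSpace M] [ChartedSpace (EuclideanSpace ℝ (Fin d)) M]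
    [IsManifold (𝓡 d) ∞ M] [T2Space M] [SecondCountableTopology M]
    {N : Type*} [TopologicalSpace N] [ChartedSpace (EuclideanSpace ℝ (Fin k)) N]
    [IsManifold (𝓡 k) ∞ N] [T2Space N] [SecondCountableTopology N]
    (P : M → N) (hP : HamiltonJacobi.IsFibration d k P)
    (X : ∀ m : M, TangentSpace (𝓡 d) m)
    (hX : ContMDiff (𝓡 d) (𝓡 d).tangent ∞ (HamiltonJacobi.fieldMap X))
    (m : M) (hm : X m ∉ (mfderiv (𝓡 d) (𝓡 k) P m).ker) :
    ∃ l : ℕ, d = k + l ∧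
      ∃ U : TopologicalSpace.Opens M, m ∈ U ∧
        ∃ (Λ : Type) (_ : TopologicalSpace Λ) (_ : ChartedSpace (EuclideanSpace ℝ (Fin l)) Λ),
          IsManifold (𝓡 l) ∞ Λ ∧ T2Space Λ ∧ SecondCountableTopology Λ ∧
            ∃ S : hP.image U × Λ → U,
              HamiltonJacobi.IsCompleteSolution d k l (hP.restrict U)
                (HamiltonJacobi.restrictField X U) S := by
  obtain ⟨l, hl, U, V, Λ, Q, S, hmU, hU, hV, hQ, hS, hQX⟩ := hP.exists_firstIntegrals hX m hm
  exact ⟨l, hl, U, hmU, Λ, inferInstance, inferInstance, inferInstance, inferInstance,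
    inferInstance, HamiltonJacobi.exists_isCompleteSolution hP X U V Λ Q S hU hV hQ hS hQX⟩
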